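/- Let $p$ be a prime, let $\nu\ge 1$ and $k\ge 0$ be integers, and let $A$ be a finite abelian group, written additively, of order $m$ with $p\nmid m$. Put $G=A\times\mathbb{Z}_{p^k}$ and let $\mathbb{F}_{p^{2\nu}}[G]=\{\sum_{g\in G}u_gY^g\}$ be the group algebra of $G$ over the field with $p^{2\nu}$ elements. An abelian code in $\mathbb{F}_{p^{2\nu}}[G]$ is an ideal $C$ of this algebra; its Hermitian dual is $C^{\perp_{\rm H}}=\{v : \sum_{g\in G}c_gv_g^{p^\nu}=0\text{ for all }c\in C\}$, and its Hermitian hull is $\mathcal{H}_{\rm H}(C)=C\cap C^{\perp_{\rm H}}$. Let $\mathrm{avg}^{\rm H}_{p^{2\nu}}(G)$ be the average of $\dim_{\mathbb{F}_{p^{2\nu}}}\mathcal{H}_{\rm H}(C)$ over all abelian codes $C$ in $\mathbb{F}_{p^{2\nu}}[G]$. For $a\in A$ let $S_{p^{2\nu}}(a)=\{p^{2\nu i}\cdot a : i=0,1,2,\dots\}$, and let $R_{p^{2\nu}}(A)=\{a\in A : -p^\nu\cdot a\in S_{p^{2\nu}}(a)\}$. Then \[ \mathrm{avg}^{\rm H}_{p^{2\nu}}(A\times\mathbb{Z}_{p^k})=mp^k\left(\frac13-\frac1{6(p^k+1)}\right)-|R_{p^{2\nu}}(A)|\left(\frac{p^k+1}{12}+\frac{2-3\delta}{12(p^k+1)}\right),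 \] where $\delta=1$ if $p=2$ and $k\ge 1$ (that is, if $p^k$ is even), and $\delta=0$ otherwise. -/

import Mathlib

/-- The Hermitian form `∑ g, u_g * v_g ^ (p ^ ν)` on the group algebra `F[G]`, where `G` is a
finite additive group (so that the sum is finite); `F` is meant to be a field with `p ^ (2 * ν)`
elements. -/
noncomputable def hermitianForm {F G : Type*} [Field F] (p ν : ℕ)
    (u v : AddMonoidAlgebra F G) : F :=
  ∑ᶠ g : G, u.coeff g * v.coeff g ^ p ^ ν

theorem hermitianForm_add_right {F G : Type*} [Field F] [Finite G] (p ν : ℕ) [Fact p.Prime]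
    [CharP F p] (u v w : AddMonoidAlgebra F G) :
    hermitianForm p ν u (v + w) = hermitianForm p ν u v + hermitianForm p ν u w := by
  unfold hermitianForm
  rw [← finsum_add_distrib (Set.toFinite _) (Set.toFinite _)]
  refine finsum_congr fun g => ?_
  rw [← mul_add, ← add_pow_char_pow]
  rfl

theorem hermitianForm_smul_right {F G : Type*} [Field F] [Finite G] (p ν : ℕ)
    (a : F) (u v : AddMonoidAlgebra F G) :
    hermitianForm p ν u (a • v) = a ^ p ^ ν * hermitianForm p ν u v := by
  unfold hermitianForm
  rw [mul_finsum' _ _ (Set.toFinite _)]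
  refine finsum_congr fun g => ?_
  have h : (a • v).coeff g = a * v.coeff g := rfl
  rw [h, mul_pow]
  ring

/-- The Hermitian dual `{v | ∀ c ∈ C, ⟨c, v⟩ = 0}` of an abelian code, that is, of an ideal `C`
of `F[G]`, as an `F`-subspace of `F[G]`. -/
noncomputable def hermitianDual {F G : Type*} [Field F] [AddCommGroup G] [Finite G] (p ν : ℕ)
    [Fact p.Prime] [CharP F p] (C : Ideal (AddMonoidAlgebra F G)) :
    Submodule F (AddMonoidAlgebra F G) where
  carrier := {v | ∀ c ∈ C, hermitianForm p ν c v = 0}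
  zero_mem' := by
    intro c _
    have h := hermitianForm_smul_right p ν (0 : F) c 0
    have hp : p ^ ν ≠ 0 := pow_ne_zero _ (Fact.out : p.Prime).ne_zero
    rwa [smul_zero, zero_pow hp, zero_mul] at h
  add_mem' := by
    intro v w hv hw c hc
    rw [hermitianForm_add_right, hv c hc, hw c hc, add_zero]
  smul_mem' := by
    intro a v hv c hc
    rw [hermitianForm_smul_right, hv c hc, mul_zero]

/-- The Hermitian hull `C ∩ C^⊥` of an abelian code. -/
noncomputable def hermitianHull {F G : Type*} [Field F] [AddCommGroup G] [Finite G] (p ν : ℕ)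
    [Fact p.Prime] [CharP F p] (C : Ideal (AddMonoidAlgebra F G)) :
    Submodule F (AddMonoidAlgebra F G) :=
  C.restrictScalars F ⊓ hermitianDual p ν C

/-- The average of the `F`-dimension of the Hermitian hull over all abelian codes in `F[G]`.
For `F` and `G` finite there are finitely many codes, so the sum is a finite sum. -/
noncomputable def avgHermitianHullDim (F G : Type*) [Field F] [AddCommGroup G] [Finite G]
    (p ν : ℕ) [Fact p.Prime] [CharP F p] : ℚ :=
  (∑ᶠ C : Ideal (AddMonoidAlgebra F G), (Module.finrank F (hermitianHull p ν C) : ℚ)) /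
    (Nat.card (Ideal (AddMonoidAlgebra F G)) : ℚ)

/-- The `q`-cyclotomic class `{q ^ i • a | i = 0, 1, …}` of `a`. -/
def cyclotomicClass {A : Type*} [AddCommGroup A] (q : ℕ) (a : A) : Set A :=
  {x | ∃ i : ℕ, x = q ^ i • a}

/-- The set of all `a` with `-p ^ ν • a` in the `p ^ (2 * ν)`-cyclotomic class of `a`. -/
def hermitianSelfPaired (A : Type*) [AddCommGroup A] (p ν : ℕ) : Set A :=
  {a | -(p ^ ν • a) ∈ cyclotomicClass (p ^ (2 * ν)) a}

/-!
Let `F` have `p ^ (2 * ν)` elements, and put `N = p ^ k` and `t = Y ^ (0, 1) - 1`. Since `p` does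
not divide the order of `A`, the Frobenius endomorphism of `F[A]` is injective, so that `F[A]` is
reduced and hence the product of its residue fields at the maximal ideals `M`. As `F[A × ZMod N]`
is free over `F[A]` with basis `1, t, …, t ^ (N - 1)`, and `t ^ N = 0`, it is a product of
uniserial rings (`isUniserialDecomposition_groupAlgebra`). So an ideal `C` is the same as a family
of exponents `e M ∈ {0, …, N}` (`IsUniserialDecomposition.idealEquiv`), where `C` contains `t ^ n`
times the idempotent of `M` exactly for `n ≥ e M`, and its dimension is the sum of
`d M * (N - e M)`, where `d M` is the degree of the residue field (`finrank_ideal`, `finrank_span_component`).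

The conjugation `∑ v_g Y^g ↦ ∑ v_g^(p^ν) Y^(-g)` is a ring involution, and it carries the Hermitian
dual of `C` to the annihilator of `C` (`mem_hermitianDual_iff`). If `σ` is its action on the
maximal ideals of `F[A]`, then the dual has the exponents `N - e (σ M)`, so that the hull has the
dimension `∑ d M * min (N - e M) (e (σ M))`. Averaging over all `e` gives, for each `M`, the mean
`N (2 N + 1) / (6 (N + 1))` if `σ M ≠ M`, and `⌊N ^ 2 / 4⌋ / (N + 1)` if `σ M = M`
(`sum_min_sub_div_card`).

There remain the sums of `d M` over all `M`, and over those with `σ M = M`. Over an algebraic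
closure `L` of `F`, the number `d M` counts the homomorphisms `F[A] → L` with kernel `M`, that is,
certain characters `χ` of `A`. Two of these homomorphisms have the same kernel if and only if they
differ by a power of the automorphism `x ↦ x ^ |F|` of `L`, and `σ` corresponds to
`χ ↦ χ ^ (-p ^ ν)`. So the invariant `M` account for the characters in the self-paired set of the character group,
which is isomorphic to `A` (`sum_finrank_residueField_invariant`).
-/

open AddMonoidAlgebra

/-! ### Ideals of a product of uniserial rings -/

/-- `R` is the product of the rings `ε i * R`, and the ideals of each `ε i * R` are the `N + 1`
distinct ones generated by `ε i * t ^ n` with `n ≤ N`. The last field expresses this by elements: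
each element of `ε i * R` that is not a multiple of `t` is invertible modulo `t`. -/
structure IsUniserialDecomposition {R I : Type*} [CommRing R] [Fintype I]
    (ε : I → R) (t : R) (N : ℕ) : Prop where
  complete : CompleteOrthogonalIdempotents ε
  pow_eq_zero : t ^ N = 0
  mul_pow_ne_zero : ∀ i n, n < N → ε i * t ^ n ≠ 0
  dvd_or_exists : ∀ i x, t ∣ ε i * x ∨ ∃ y, t ∣ ε i - y * (ε i * x)

/-- The least `n` with `ε i * t ^ n ∈ C`. -/
noncomputable def idealExponent {R I : Type*} [CommRing R] (ε : I → R) (t : R) (C : Ideal R)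
    (i : I) : ℕ :=
  sInf {n | ε i * t ^ n ∈ C}

namespace IsUniserialDecomposition

variable {R I : Type*} [CommRing R] [Fintype I] {ε : I → R} {t : R} {N : ℕ}

theorem mul_self (h : IsUniserialDecomposition ε t N) (i : I) : ε i * ε i = ε i :=
  h.complete.idem i

theorem mul_of_ne (h : IsUniserialDecomposition ε t N) {i j : I} (hij : i ≠ j) : ε i * ε j = 0 :=
  h.complete.ortho hij

theorem mul_pow_eq_zero_iff (h : IsUniserialDecomposition ε t N) (i : I) (n : ℕ) :
    ε i * t ^ n = 0 ↔ N ≤ n := by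
  constructor
  · intro h0
    by_contra hn
    exact h.mul_pow_ne_zero i n (by omega) h0
  · intro hn
    rw [pow_eq_zero_of_le hn h.pow_eq_zero, mul_zero]

/-- Every nonzero element of `ε i * R` is associated to a power of `t`. -/
theorem exists_dvd_dvd (h : IsUniserialDecomposition ε t N) (i : I) (x : R) (hx : ε i * x ≠ 0) :
    ∃ n, ε i * t ^ n ∣ ε i * x ∧ ε i * x ∣ ε i * t ^ n := by
  classical
  have hbound : ∀ n, ε i * t ^ n ∣ ε i * x → n ≤ N := by
    rintro n ⟨y, hy⟩
    by_contra hn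
    exact hx (by rw [hy, (h.mul_pow_eq_zero_iff i n).2 (by omega), zero_mul])
  let n := Nat.findGreatest (fun n => ε i * t ^ n ∣ ε i * x) N
  have hn : ε i * t ^ n ∣ ε i * x :=
    Nat.findGreatest_spec (P := fun n => ε i * t ^ n ∣ ε i * x) (Nat.zero_le N) (by simp)
  refine ⟨n, hn, ?_⟩
  obtain ⟨y, hy⟩ := hn
  rcases h.dvd_or_exists i y with ⟨z, hz⟩ | ⟨w, z, hz⟩
  · -- otherwise one more power of `t` could be split off
    have hlt : ε i * t ^ (n + 1) ∣ ε i * x := by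
      refine ⟨z, ?_⟩
      linear_combination hy + t ^ n * ε i * hz - t ^ n * y * h.mul_self i
    have := Nat.le_findGreatest (P := fun n => ε i * t ^ n ∣ ε i * x) (hbound _ hlt) hlt
    exact absurd this (by simp [n])
  · have hnil : IsNilpotent (-(t * z)) := by
      refine ⟨N, ?_⟩
      rw [← mul_neg, mul_pow, h.pow_eq_zero, zero_mul]
    obtain ⟨u, hu⟩ := hnil.isUnit_one_add
    refine ⟨w * ↑u⁻¹, ?_⟩
    have key : ε i * t ^ n * (u : R) = ε i * x * w := by
      rw [hu]
      linear_combination ε i * t ^ n * hz - w * hy + (-(t ^ n) + t ^ n * w * y) * h.mul_self i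
    calc ε i * t ^ n = ε i * t ^ n * (u : R) * ↑u⁻¹ := by rw [mul_assoc, Units.mul_inv, mul_one]
      _ = _ := by rw [key]; ring

theorem ideal_le (h : IsUniserialDecomposition ε t N) {C D : Ideal R}
    (hCD : ∀ i n, ε i * t ^ n ∈ C → ε i * t ^ n ∈ D) : C ≤ D := by
  intro c hc
  have : c = ∑ i, ε i * c := by rw [← Finset.sum_mul, h.complete.complete, one_mul]
  rw [this]
  refine D.sum_mem fun i _ => ?_
  by_cases h0 : ε i * c = 0
  · rw [h0]
    exact D.zero_mem
  · obtain ⟨n, h1, h2⟩ := h.exists_dvd_dvd i c h0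
    exact D.mem_of_dvd h1 (hCD i n (C.mem_of_dvd h2 (C.mul_mem_left _ hc)))

/-- An ideal is determined by the products `ε i * t ^ n` that it contains. -/
theorem ideal_ext (h : IsUniserialDecomposition ε t N) {C D : Ideal R}
    (hCD : ∀ i n, ε i * t ^ n ∈ C ↔ ε i * t ^ n ∈ D) : C = D :=
  le_antisymm (h.ideal_le fun i n => (hCD i n).1) (h.ideal_le fun i n => (hCD i n).2)

theorem mem_iff (h : IsUniserialDecomposition ε t N) (C : Ideal R) (i : I) (n : ℕ) :
    ε i * t ^ n ∈ C ↔ idealExponent ε t C i ≤ n := by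
  constructor
  · exact fun hn => Nat.sInf_le hn
  · intro hn
    have hne : {n | ε i * t ^ n ∈ C}.Nonempty := ⟨N, by simp [h.pow_eq_zero]⟩
    have hmem : ε i * t ^ idealExponent ε t C i ∈ C := Nat.sInf_mem hne
    obtain ⟨d, rfl⟩ := Nat.exists_eq_add_of_le hn
    rw [pow_add, ← mul_assoc]
    exact C.mul_mem_right _ hmem

theorem idealExponent_le (h : IsUniserialDecomposition ε t N) (C : Ideal R) (i : I) :
    idealExponent ε t C i ≤ N :=
  (h.mem_iff C i N).1 (by simp [h.pow_eq_zero])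

theorem idealExponent_eq (h : IsUniserialDecomposition ε t N) (C : Ideal R) (i : I) (m : ℕ)
    (hm : ∀ n, ε i * t ^ n ∈ C ↔ m ≤ n) : idealExponent ε t C i = m :=
  le_antisymm ((h.mem_iff C i m).1 ((hm m).2 le_rfl))
    ((hm _).1 ((h.mem_iff C i _).2 le_rfl))

theorem exists_ideal (h : IsUniserialDecomposition ε t N) (e : I → ℕ) (he : ∀ i, e i ≤ N) :
    ∃ C : Ideal R, ∀ i, idealExponent ε t C i = e i := by
  classical
  refine ⟨(Ideal.span (Set.range fun j => ε j * t ^ (N - e j))).annihilator, fun i =>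
    h.idealExponent_eq _ _ _ fun n => ?_⟩
  have hi := he i
  simp only [Ideal.span, Submodule.mem_annihilator_span, Subtype.forall, Set.forall_mem_range,
    smul_eq_mul]
  have key : ε i * t ^ n * (ε i * t ^ (N - e i)) = ε i * t ^ (n + (N - e i)) := by
    rw [pow_add]
    linear_combination t ^ n * t ^ (N - e i) * h.mul_self i
  constructor
  · intro hall
    have := hall i
    rw [key, h.mul_pow_eq_zero_iff] at this
    omega
  · intro hn j
    by_cases hij : i = j
    · subst hij
      rw [key, h.mul_pow_eq_zero_iff]
      omega
    · linear_combination t ^ n * t ^ (N - e j) * h.mul_of_ne hij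

theorem idealExponent_annihilator (h : IsUniserialDecomposition ε t N) (C : Ideal R) (i : I) :
    idealExponent ε t C.annihilator i = N - idealExponent ε t C i := by
  refine h.idealExponent_eq _ _ _ fun n => ?_
  rw [Submodule.mem_annihilator]
  constructor
  · intro hn
    have h0 := hn _ ((h.mem_iff C i _).2 le_rfl)
    rw [smul_eq_mul] at h0
    have : ε i * t ^ (n + idealExponent ε t C i) = 0 := by
      rw [pow_add]
      linear_combination h0 - t ^ n * t ^ idealExponent ε t C i * h.mul_self i
    rw [h.mul_pow_eq_zero_iff] at this
    omega
  · intro hn c hc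
    rw [smul_eq_mul]
    by_cases h0 : ε i * c = 0
    · linear_combination t ^ n * h0
    · obtain ⟨l, ⟨y, hy⟩, h2⟩ := h.exists_dvd_dvd i c h0
      have hl := (h.mem_iff C i l).1 (C.mem_of_dvd h2 (C.mul_mem_left _ hc))
      have hz := (h.mul_pow_eq_zero_iff i (n + l)).2 (by omega)
      rw [pow_add] at hz
      linear_combination t ^ n * hy + y * hz

/-- The ideals of `R` are parametrized by their exponents. -/
noncomputable def idealEquiv (h : IsUniserialDecomposition ε t N) :
    Ideal R ≃ (I → Fin (N + 1)) :=
  Equiv.ofBijective (fun C i => ⟨idealExponent ε t C i, Nat.lt_succ_of_le (h.idealExponent_le C i)⟩)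
    ⟨fun C D hCD => h.ideal_ext fun i n => by
      rw [h.mem_iff, h.mem_iff, show idealExponent ε t C i = idealExponent ε t D i from
        congrArg Fin.val (congrFun hCD i)],
    fun e => by
      obtain ⟨C, hC⟩ := h.exists_ideal (fun i => e i) fun i => Nat.le_of_lt_succ (e i).2
      exact ⟨C, funext fun i => Fin.ext (hC i)⟩⟩

theorem idealEquiv_apply (h : IsUniserialDecomposition ε t N) (C : Ideal R) (i : I) :
    (h.idealEquiv C i : ℕ) = idealExponent ε t C i := rfl

section Dimension

variable {F : Type*} [Field F] [Algebra F R]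

/-- Multiplication by `ε i * t ^ (N - 1 - e i)`, where `e i` is the exponent of `C`, maps `C` onto
the minimal ideal generated by `ε i * t ^ (N - 1)`, and its kernel is the ideal whose exponent at
`i` is one larger than that of `C`. -/
theorem exists_finrank_eq_add [FiniteDimensional F R] (h : IsUniserialDecomposition ε t N)
    (C : Ideal R) (i : I) (hi : idealExponent ε t C i < N) :
    ∃ D : Ideal R, idealExponent ε t D i = idealExponent ε t C i + 1 ∧
      (∀ j, j ≠ i → idealExponent ε t D j = idealExponent ε t C j) ∧
      Module.finrank F (C.restrictScalars F) =
        Module.finrank F ((Ideal.span {ε i * t ^ (N - 1)}).restrictScalars F) +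
          Module.finrank F (D.restrictScalars F) := by
  set e := idealExponent ε t C i with he
  set s := ε i * t ^ (N - 1 - e) with hs
  let D : Ideal R := C ⊓ (Ideal.span {s}).annihilator
  have hD : ∀ x, x ∈ D ↔ x ∈ C ∧ x * s = 0 := by
    intro x
    simp [D, Ideal.span]
  refine ⟨D, ?_, ?_, ?_⟩
  · refine h.idealExponent_eq _ _ _ fun n => ?_
    have key : ε i * t ^ n * s = ε i * t ^ (n + (N - 1 - e)) := by
      rw [pow_add]
      linear_combination t ^ n * t ^ (N - 1 - e) * h.mul_self i
    rw [hD, key, h.mul_pow_eq_zero_iff, h.mem_iff]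
    omega
  · intro j hj
    refine h.idealExponent_eq _ _ _ fun n => ?_
    have key : ε j * t ^ n * s = 0 := by
      linear_combination t ^ n * t ^ (N - 1 - e) * h.mul_of_ne hj
    rw [hD, h.mem_iff]
    simp [key]
  · let f : R →ₗ[F] R := LinearMap.mulRight F s
    let g : C.restrictScalars F →ₗ[F] R := f.domRestrict (C.restrictScalars F)
    have hrange : LinearMap.range g = (Ideal.span {ε i * t ^ (N - 1)}).restrictScalars F := by
      ext x
      simp only [LinearMap.mem_range, Submodule.restrictScalars_mem, Ideal.mem_span_singleton]
      constructor
      · rintro ⟨⟨c, hc⟩, rfl⟩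
        change _ ∣ c * s
        by_cases h0 : ε i * c = 0
        · rw [show c * s = 0 by linear_combination t ^ (N - 1 - e) * h0]
          exact dvd_zero _
        · obtain ⟨n, ⟨y, hy⟩, h2⟩ := h.exists_dvd_dvd i c h0
          have hn : e ≤ n := (h.mem_iff C i n).1 (C.mem_of_dvd h2 (C.mul_mem_left _ hc))
          refine ⟨t ^ (n - e) * y, ?_⟩
          have : t ^ (N - 1) * t ^ (n - e) = t ^ n * t ^ (N - 1 - e) := by
            rw [← pow_add, ← pow_add]
            congr 1
            omega
          linear_combination t ^ (N - 1 - e) * hy - ε i * y * this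
      · rintro ⟨y, rfl⟩
        refine ⟨⟨ε i * t ^ e * y, C.mul_mem_right _ ((h.mem_iff C i e).2 le_rfl)⟩, ?_⟩
        change ε i * t ^ e * y * s = _
        have : t ^ e * t ^ (N - 1 - e) = t ^ (N - 1) := by
          rw [← pow_add]
          congr 1
          omega
        linear_combination ε i * y * this + t ^ e * y * t ^ (N - 1 - e) * h.mul_self i
    have hker : Module.finrank F (LinearMap.ker g) = Module.finrank F (D.restrictScalars F) := by
      have : (LinearMap.ker g).map (C.restrictScalars F).subtype = D.restrictScalars F := by
        ext x
        simp only [Submodule.mem_map, LinearMap.mem_ker, Submodule.restrictScalars_mem, hD]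
        constructor
        · rintro ⟨⟨c, hc⟩, h0, rfl⟩
          exact ⟨hc, h0⟩
        · rintro ⟨hx, h0⟩
          exact ⟨⟨x, hx⟩, h0, rfl⟩
      rw [← this]
      exact (LinearEquiv.finrank_eq (Submodule.equivMapOfInjective _
        (Submodule.injective_subtype _) _))
    rw [← LinearMap.finrank_range_add_finrank_ker g, hker, hrange]

theorem finrank_ideal [FiniteDimensional F R] (h : IsUniserialDecomposition ε t N) (C : Ideal R) :
    Module.finrank F (C.restrictScalars F) =
      ∑ i, (N - idealExponent ε t C i) *
        Module.finrank F ((Ideal.span {ε i * t ^ (N - 1)}).restrictScalars F) := by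
  classical
  induction hs : ∑ i, (N - idealExponent ε t C i) using Nat.strong_induction_on generalizing C with
  | _ s ih =>
    by_cases hlt : ∃ i, idealExponent ε t C i < N
    · obtain ⟨i, hi⟩ := hlt
      obtain ⟨D, hDi, hDj, hfin⟩ := h.exists_finrank_eq_add (F := F) C i hi
      have hsum : ∀ d : I → ℕ, ∑ j, (N - idealExponent ε t C j) * d j =
          d i + ∑ j, (N - idealExponent ε t D j) * d j := by
        intro d
        rw [← Finset.add_sum_erase _ _ (Finset.mem_univ i),
          ← Finset.add_sum_erase (a := i) _ (fun j => (N - idealExponent ε t D j) * d j)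
            (Finset.mem_univ i), ← add_assoc]
        congr 1
        · rw [hDi, show N - idealExponent ε t C i = N - (idealExponent ε t C i + 1) + 1 by omega]
          ring
        · exact Finset.sum_congr rfl fun j hj => by rw [hDj j (Finset.ne_of_mem_erase hj)]
      rw [hsum, hfin, ih (∑ j, (N - idealExponent ε t D j)) ?_ D rfl]
      have := hsum fun _ => 1
      simp only [mul_one] at this
      omega
    · push Not at hlt
      have hC : C = ⊥ := h.ideal_ext fun i n => by
        rw [h.mem_iff, Ideal.mem_bot, h.mul_pow_eq_zero_iff,
          le_antisymm (h.idealExponent_le C i) (hlt i)]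
      rw [Finset.sum_eq_zero fun i _ => by rw [Nat.sub_eq_zero_of_le (hlt i), zero_mul], hC,
        Submodule.restrictScalars_bot, finrank_bot]

end Dimension

end IsUniserialDecomposition

/-! ### Averages over families of exponents -/

theorem card_mul_sum_apply {I X : Type*} [Fintype I] [Fintype X] [DecidableEq I] (i : I)
    (g : X → ℚ) :
    (Fintype.card X : ℚ) * ∑ e : I → X, g (e i) = Fintype.card (I → X) * ∑ x, g x := by
  rw [Fintype.sum_equiv (Equiv.funSplitAt i X) (fun e => g (e i)) (fun q => g q.1) fun e => rfl,
    Fintype.card_congr (Equiv.funSplitAt i X), Fintype.sum_prod_type, Fintype.card_prod]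
  simp only [Finset.sum_const, Finset.card_univ, nsmul_eq_mul, ← Finset.mul_sum]
  push_cast
  ring

theorem card_sq_mul_sum_apply_apply {I X : Type*} [Fintype I] [Fintype X] [DecidableEq I] {i j : I}
    (hij : i ≠ j) (g : X → X → ℚ) :
    (Fintype.card X : ℚ) ^ 2 * ∑ e : I → X, g (e i) (e j) =
      Fintype.card (I → X) * ∑ x, ∑ y, g x y := by
  rw [Fintype.sum_equiv (Equiv.funSplitAt i X) (fun e => g (e i) (e j))
    (fun q => g q.1 (q.2 ⟨j, hij.symm⟩)) fun e => rfl,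
    Fintype.card_congr (Equiv.funSplitAt i X), Fintype.sum_prod_type, Fintype.card_prod, sq,
    mul_assoc, Finset.mul_sum]
  simp only [card_mul_sum_apply]
  rw [← Finset.mul_sum]
  push_cast
  ring

theorem sum_range_min_sub (N : ℕ) :
    ∑ x ∈ Finset.range (N + 1), min (N - x) x = N ^ 2 / 4 := by
  induction N using Nat.strong_induction_on with
  | _ N ih =>
    match N with
    | 0 => rfl
    | 1 => rfl
    | n + 2 =>
      rw [Finset.sum_range_succ, Finset.sum_range_succ']
      have : ∀ x ∈ Finset.range (n + 1), min (n + 2 - (x + 1)) (x + 1) = min (n - x) x + 1 := by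
        intro x hx
        have := Finset.mem_range.1 hx
        omega
      rw [Finset.sum_congr rfl this, Finset.sum_add_distrib, ih n (by omega)]
      have h4 : (n + 2) ^ 2 = n ^ 2 + (n + 1) * 4 := by ring
      rw [h4, Nat.add_mul_div_right _ _ (by norm_num)]
      simp

theorem sum_range_sum_range_min (N : ℕ) :
    6 * ∑ x ∈ Finset.range (N + 1), ∑ y ∈ Finset.range (N + 1), min x y =
      N * (N + 1) * (2 * N + 1) := by
  induction N with
  | zero => rfl
  | succ n ih =>
    have h1 : ∀ x ∈ Finset.range (n + 1), ∑ y ∈ Finset.range (n + 1 + 1), min x y =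
        ∑ y ∈ Finset.range (n + 1), min x y + x := by
      intro x hx
      have := Finset.mem_range.1 hx
      rw [Finset.sum_range_succ, min_eq_left (by omega)]
    have h2 : ∀ y ∈ Finset.range (n + 1), min (n + 1) y = y := by
      intro y hy
      have := Finset.mem_range.1 hy
      omega
    have h3 := Finset.sum_range_id_mul_two (n + 1)
    rw [Finset.sum_range_succ, Finset.sum_congr rfl h1, Finset.sum_add_distrib,
      Finset.sum_range_succ _ (n + 1), Finset.sum_congr rfl h2, min_self]
    rw [Nat.add_sub_cancel] at h3
    linear_combination ih + 6 * h3

theorem sum_fin_sum_fin_min_sub (N : ℕ) :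
    6 * ∑ x : Fin (N + 1), ∑ y : Fin (N + 1), min (N - (x : ℕ)) (y : ℕ) =
      N * (N + 1) * (2 * N + 1) := by
  rw [← sum_range_sum_range_min,
    Fin.sum_univ_eq_sum_range (fun x => ∑ y : Fin (N + 1), min (N - x) (y : ℕ)) (N + 1),
    ← Finset.sum_range_reflect (fun x => ∑ y ∈ Finset.range (N + 1), min x y)]
  congr 1
  refine Finset.sum_congr rfl fun x _ => ?_
  rw [Fin.sum_univ_eq_sum_range (fun y => min (N - x) y) (N + 1)]
  simp

/-- If the exponents `e i` are independent and uniformly distributed in `{0, …, N}`, then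
`min (N - e i) (e (σ i))` has the mean `⌊N ^ 2 / 4⌋ / (N + 1)` if `σ i = i`, and
`N (2 N + 1) / (6 (N + 1))` otherwise. -/
theorem sum_min_sub_div_card {I : Type*} [Fintype I] [DecidableEq I] (N : ℕ) (σ : I → I) (i : I) :
    (∑ e : I → Fin (N + 1), ((min (N - (e i : ℕ)) (e (σ i) : ℕ) : ℕ) : ℚ)) /
        Fintype.card (I → Fin (N + 1)) =
      if σ i = i then ((N ^ 2 / 4 : ℕ) : ℚ) / (N + 1)
      else (N : ℚ) * (2 * N + 1) / (6 * (N + 1)) := by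
  have hN : (N : ℚ) + 1 ≠ 0 := by positivity
  have hc : (Fintype.card (I → Fin (N + 1)) : ℚ) ≠ 0 := by
    exact_mod_cast Fintype.card_ne_zero
  split_ifs with h
  · have h1 := card_mul_sum_apply i fun x : Fin (N + 1) => ((min (N - (x : ℕ)) (x : ℕ) : ℕ) : ℚ)
    have h2 : ∑ x : Fin (N + 1), ((min (N - (x : ℕ)) (x : ℕ) : ℕ) : ℚ) = ((N ^ 2 / 4 : ℕ) : ℚ) := by
      rw [← sum_range_min_sub, ← Fin.sum_univ_eq_sum_range (fun x => min (N - x) x) (N + 1),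
        Nat.cast_sum]
    rw [h2, Fintype.card_fin] at h1
    rw [h, div_eq_div_iff hc hN]
    push_cast at h1 ⊢
    linear_combination h1
  · have h1 := card_sq_mul_sum_apply_apply (Ne.symm h)
      fun x y : Fin (N + 1) => ((min (N - (x : ℕ)) (y : ℕ) : ℕ) : ℚ)
    have h2 : 6 * ∑ x : Fin (N + 1), ∑ y : Fin (N + 1), ((min (N - (x : ℕ)) (y : ℕ) : ℕ) : ℚ) =
        N * (N + 1) * (2 * N + 1) := by
      exact_mod_cast sum_fin_sum_fin_min_sub N
    rw [Fintype.card_fin] at h1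
    rw [div_eq_div_iff hc (by positivity)]
    refine mul_left_cancel₀ hN ?_
    push_cast at h1 h2 ⊢
    linear_combination 6 * h1 + (Fintype.card (I → Fin (N + 1)) : ℚ) * h2

/-! ### The conjugation of a group algebra -/

section Conjugation

variable {F G : Type*} [Field F] [AddCommGroup G] (p ν : ℕ) [Fact p.Prime] [CharP F p]

/-- The ring endomorphism `∑ v_g Y^g ↦ ∑ v_g^(p^ν) Y^(-g)` of `F[G]`. -/
noncomputable def groupAlgebraConj (F G : Type*) [Field F] [AddCommGroup G] (p ν : ℕ)
    [Fact p.Prime] [CharP F p] : AddMonoidAlgebra F G →+* AddMonoidAlgebra F G :=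
  (mapDomainRingHom F (negAddMonoidHom : G →+ G)).comp (mapRingHom G (iterateFrobenius F p ν))

theorem groupAlgebraConj_single (g : G) (r : F) :
    groupAlgebraConj F G p ν (single g r) = single (-g) (r ^ p ^ ν) := by
  simp [groupAlgebraConj, iterateFrobenius_def]

theorem coeff_groupAlgebraConj (v : AddMonoidAlgebra F G) (g : G) :
    (groupAlgebraConj F G p ν v).coeff (-g) = v.coeff g ^ p ^ ν := by
  have : groupAlgebraConj F G p ν v = mapDomain (fun x : G => -x)
    (mapRingHom G (iterateFrobenius F p ν) v) := rfl
  rw [this, coeff_mapDomain, Finsupp.mapDomain_apply neg_injective]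
  simp [iterateFrobenius_def]

theorem pow_pow_eq_self_of_card {F : Type*} [Field F] {p ν : ℕ} [Fact p.Prime]
    (hF : Nat.card F = p ^ (2 * ν)) (r : F) : (r ^ p ^ ν) ^ p ^ ν = r := by
  have hfin : Finite F := Nat.finite_of_card_ne_zero (by
    rw [hF]; exact pow_ne_zero _ (Fact.out : p.Prime).ne_zero)
  have := Fintype.ofFinite F
  rw [← pow_mul, ← pow_add, ← two_mul, ← hF, Nat.card_eq_fintype_card, FiniteField.pow_card]

theorem groupAlgebraConj_groupAlgebraConj (hF : Nat.card F = p ^ (2 * ν))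
    (v : AddMonoidAlgebra F G) :
    groupAlgebraConj F G p ν (groupAlgebraConj F G p ν v) = v := by
  have hcomp : (groupAlgebraConj F G p ν).comp (groupAlgebraConj F G p ν) = RingHom.id _ := by
    apply AddMonoidAlgebra.ringHom_ext
    · intro r
      simp [groupAlgebraConj_single, pow_pow_eq_self_of_card hF]
    · intro g
      simp [groupAlgebraConj_single]
  exact RingHom.congr_fun hcomp v

theorem coeff_zero_mul_groupAlgebraConj [Finite G] (c v : AddMonoidAlgebra F G) :
    (c * groupAlgebraConj F G p ν v).coeff 0 = hermitianForm p ν c v := by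
  induction c using AddMonoidAlgebra.induction_linear with
  | zero => simp [hermitianForm]
  | add c d hc hd =>
    rw [add_mul, coeff_add, Finsupp.add_apply, hc, hd]
    unfold hermitianForm
    rw [← finsum_add_distrib (Set.toFinite _) (Set.toFinite _)]
    exact finsum_congr fun g => by simp [add_mul]
  | single g r =>
    rw [coeff_single_mul_eq_mul_coeff (-g) fun x _ => by rw [add_comm, add_eq_zero_iff_eq_neg],
      coeff_groupAlgebraConj]
    unfold hermitianForm
    rw [finsum_eq_single _ g fun x hx => by simp [hx.symm]]
    simp

theorem mem_hermitianDual_iff [Finite G] (C : Ideal (AddMonoidAlgebra F G))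
    (v : AddMonoidAlgebra F G) :
    v ∈ hermitianDual p ν C ↔ groupAlgebraConj F G p ν v ∈ C.annihilator := by
  change (∀ c ∈ C, hermitianForm p ν c v = 0) ↔ _
  rw [Submodule.mem_annihilator]
  constructor
  · intro h c hc
    ext g
    have h0 := h (single (-g) 1 * c) (C.mul_mem_left _ hc)
    rw [← coeff_zero_mul_groupAlgebraConj, mul_assoc,
      coeff_single_mul_eq_mul_coeff g fun x _ => by rw [neg_add_eq_zero, eq_comm], one_mul] at h0
    rw [smul_eq_mul, mul_comm, h0]
    rfl
  · intro h c hc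
    rw [← coeff_zero_mul_groupAlgebraConj, mul_comm, ← smul_eq_mul, h c hc]
    rfl

end Conjugation

/-! ### Semisimplicity of `F[A]` -/

theorem charP_addMonoidAlgebra {F : Type*} [Field F] (p : ℕ) [CharP F p] {A : Type*}
    [AddCommGroup A] : CharP (AddMonoidAlgebra F A) p :=
  charP_of_injective_algebraMap (algebraMap F (AddMonoidAlgebra F A)).injective p

/-- The Frobenius endomorphism of `F[A]` is injective because multiplication by `p` is injective
on `A`. -/
theorem isReduced_addMonoidAlgebra {F : Type*} [Field F] (p : ℕ) [Fact p.Prime] [CharP F p]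
    {A : Type*} [AddCommGroup A] [Finite A] (hA : ¬ p ∣ Nat.card A) :
    IsReduced (AddMonoidAlgebra F A) := by
  have := charP_addMonoidAlgebra (F := F) (A := A) p
  have hp : p.Prime := Fact.out
  rw [isReduced_iff_pow_one_lt p hp.one_lt]
  intro x hx
  have hfrob : frobenius (AddMonoidAlgebra F A) p =
      (mapDomainRingHom F (nsmulAddMonoidHom p : A →+ A)).comp (mapRingHom A (frobenius F p)) := by
    apply AddMonoidAlgebra.ringHom_ext
    · intro r
      simp [frobenius_def, single_pow]
    · intro g
      simp [frobenius_def, single_pow]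
  have hinj : Function.Injective (frobenius (AddMonoidAlgebra F A) p) := by
    rw [hfrob, RingHom.coe_comp]
    refine (mapDomain_injective (f := fun a : A => p • a) ?_).comp
      (map_injective _ (frobenius_inj F p))
    exact (nsmulCoprime (hp.coprime_iff_not_dvd.2 hA).symm).injective
  exact hinj (by rw [frobenius_def, hx, map_zero])

/-! ### The group algebra of `A × ZMod (p ^ k)` over `F[A]` -/

section Extension

variable (F A : Type*) [Field F] [AddCommGroup A] (N : ℕ)

/-- The inclusion of `F[A]` into `F[A × ZMod N]`. -/
noncomputable def groupAlgebraInl : AddMonoidAlgebra F A →+* AddMonoidAlgebra F (A × ZMod N) :=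
  mapDomainRingHom F (AddMonoidHom.inl A (ZMod N))

/-- The projection of `F[A × ZMod N]` onto `F[A]`. -/
noncomputable def groupAlgebraFst : AddMonoidAlgebra F (A × ZMod N) →+* AddMonoidAlgebra F A :=
  mapDomainRingHom F (AddMonoidHom.fst A (ZMod N))

/-- The element `Y^(0, 1) - 1` of `F[A × ZMod N]`, which generates the kernel of the projection
onto `F[A]`. -/
noncomputable def cyclicUniformizer : AddMonoidAlgebra F (A × ZMod N) :=
  single (0, 1) 1 - 1

variable {F A N}

theorem groupAlgebraInl_single (a : A) (r : F) :
    groupAlgebraInl F A N (single a r) = single (a, 0) r := by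
  simp [groupAlgebraInl]

theorem cyclicUniformizer_dvd [NeZero N] (x : AddMonoidAlgebra F (A × ZMod N)) :
    cyclicUniformizer F A N ∣ x - groupAlgebraInl F A N (groupAlgebraFst F A N x) := by
  induction x using AddMonoidAlgebra.induction_linear with
  | zero => simp
  | add x y hx hy =>
    rw [map_add, map_add, add_sub_add_comm]
    exact dvd_add hx hy
  | single g r =>
    obtain ⟨a, z⟩ := g
    have h1 : (single (a, z) r : AddMonoidAlgebra F (A × ZMod N)) =
        single (a, 0) r * (single (0, 1) 1) ^ z.val := by
      simp [single_pow]
    have h2 : groupAlgebraInl F A N (groupAlgebraFst F A N (single (a, z) r)) =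
        single (a, 0) r := by
      simp [groupAlgebraInl, groupAlgebraFst]
    rw [h1, ← h1, h2, h1, ← mul_sub_one]
    exact Dvd.dvd.mul_left (sub_one_dvd_pow_sub_one _ _) _

theorem cyclicUniformizer_pow_card (p : ℕ) [Fact p.Prime] [CharP F p] (k : ℕ) :
    cyclicUniformizer F A (p ^ k) ^ p ^ k = 0 := by
  have := charP_addMonoidAlgebra (F := F) (A := A × ZMod (p ^ k)) p
  rw [cyclicUniformizer, sub_pow_char_pow, single_pow, one_pow]
  have h : p ^ k • ((0, 1) : A × ZMod (p ^ k)) = 0 := by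
    ext
    · simp
    · simp only [Prod.smul_snd, nsmul_eq_mul, mul_one, Prod.snd_zero]
      exact ZMod.natCast_self _
  rw [h, one_pow, ← one_def, sub_self]

theorem coeff_groupAlgebraInl (b : AddMonoidAlgebra F A) (a : A) (z : ZMod N) :
    (groupAlgebraInl F A N b).coeff (a, z) = if z = 0 then b.coeff a else 0 := by
  have : groupAlgebraInl F A N b = mapDomain (fun a : A => (a, (0 : ZMod N))) b := rfl
  rw [this, coeff_mapDomain]
  split_ifs with hz
  · subst hz
    exact Finsupp.mapDomain_apply (fun a b h => (Prod.ext_iff.1 h).1) _ a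
  · refine Finsupp.mapDomain_of_notMem_range _ _ ?_
    rintro ⟨a', h⟩
    exact hz (Prod.ext_iff.1 h).2.symm

theorem groupAlgebraInl_smul (c : F) (b : AddMonoidAlgebra F A) :
    groupAlgebraInl F A N (c • b) = c • groupAlgebraInl F A N b := by
  ext ⟨a, z⟩
  simp [coeff_groupAlgebraInl]

/-- In characteristic `p` we have `(X - 1) ^ (p ^ k - 1) = ∑ X ^ j`, where `j < p ^ k`, so that
`b` consists of the coefficients of the product at the elements `(a, 0)`. -/
theorem eq_zero_of_mul_cyclicUniformizer_pow (p : ℕ) [Fact p.Prime] [CharP F p] (k : ℕ)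
    (b : AddMonoidAlgebra F A)
    (h : groupAlgebraInl F A (p ^ k) b * cyclicUniformizer F A (p ^ k) ^ (p ^ k - 1) = 0) :
    b = 0 := by
  have hN : 0 < p ^ k := pow_pos (Fact.out : p.Prime).pos k
  have : NeZero (p ^ k) := ⟨hN.ne'⟩
  have hgeom : cyclicUniformizer F A (p ^ k) ^ (p ^ k - 1) =
      ∑ j ∈ Finset.range (p ^ k), single (0, (j : ZMod (p ^ k))) 1 := by
    have hX : ((Polynomial.X : Polynomial F) - 1) ^ (p ^ k - 1) =
        ∑ j ∈ Finset.range (p ^ k), Polynomial.X ^ j := by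
      refine mul_right_cancel₀ (Polynomial.X_sub_C_ne_zero (1 : F)) ?_
      rw [map_one, geom_sum_mul, ← pow_succ, Nat.sub_add_cancel hN, sub_pow_char_pow, one_pow]
    have := congrArg (Polynomial.aeval (single ((0 : A), (1 : ZMod (p ^ k))) (1 : F))) hX
    simpa [single_pow, cyclicUniformizer] using this
  ext a
  have ha := congrArg (fun x => x.coeff (a, (0 : ZMod (p ^ k)))) h
  simp only [hgeom, Finset.mul_sum, coeff_sum, Finsupp.finsetSum_apply] at ha
  rw [Finset.sum_eq_single 0] at ha
  · rw [coeff_mul_single_eq_coeff_mul (a, (0 : ZMod (p ^ k))) (by simp), mul_one,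
      coeff_groupAlgebraInl, if_pos rfl] at ha
    exact ha
  · intro j hj hj0
    rw [coeff_mul_single_eq_coeff_mul (a, -(j : ZMod (p ^ k))) fun x _ => by
        rw [← eq_sub_iff_add_eq, Prod.mk_sub_mk, sub_zero, zero_sub], mul_one,
      coeff_groupAlgebraInl, if_neg]
    rw [neg_eq_zero, ZMod.natCast_eq_zero_iff]
    exact fun hd => hj0 (Nat.eq_zero_of_dvd_of_lt hd (Finset.mem_range.1 hj))
  · intro h0
    exact absurd (Finset.mem_range.2 hN) h0

theorem groupAlgebraConj_groupAlgebraInl (p ν : ℕ) [Fact p.Prime] [CharP F p]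
    (b : AddMonoidAlgebra F A) :
    groupAlgebraConj F _ p ν (groupAlgebraInl F A N b) =
      groupAlgebraInl F A N (groupAlgebraConj F A p ν b) := by
  have : (groupAlgebraConj F _ p ν).comp (groupAlgebraInl F A N) =
      (groupAlgebraInl F A N).comp (groupAlgebraConj F A p ν) := by
    apply AddMonoidAlgebra.ringHom_ext <;>
      simp [groupAlgebraConj_single, groupAlgebraInl_single]
  exact RingHom.congr_fun this b

theorem groupAlgebraConj_cyclicUniformizer (p ν : ℕ) [Fact p.Prime] [CharP F p] :
    ∃ u : (AddMonoidAlgebra F (A × ZMod N))ˣ,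
      groupAlgebraConj F _ p ν (cyclicUniformizer F A N) = u * cyclicUniformizer F A N := by
  refine ⟨⟨-single (0, -1) 1, -single (0, 1) 1, ?_, ?_⟩, ?_⟩
  · simp [one_def, Prod.zero_eq_mk]
  · simp [one_def, Prod.zero_eq_mk]
  · change _ = -single (0, -1) 1 * (single (0, 1) 1 - 1)
    rw [cyclicUniformizer, map_sub, map_one, groupAlgebraConj_single, neg_mul, mul_sub,
      single_mul_single]
    simp [one_def, Prod.zero_eq_mk]

end Extension

/-! ### Idempotents of a reduced Artinian ring -/

section Idempotents

variable {B : Type*} [CommRing B] [IsArtinianRing B] [IsReduced B]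

/-- The idempotent of a reduced Artinian ring that is `1` modulo the maximal ideal `M` and `0`
modulo all others. -/
noncomputable def maximalIdempotent (M : MaximalSpectrum B) : B :=
  letI := Classical.decEq (MaximalSpectrum B)
  (IsArtinianRing.equivPi B).symm (Pi.single M 1)

theorem quotient_mk_maximalIdempotent (M M' : MaximalSpectrum B) [Decidable (M' = M)] :
    Ideal.Quotient.mk M'.asIdeal (maximalIdempotent M) = if M' = M then 1 else 0 := by
  let _ := Classical.decEq (MaximalSpectrum B)
  have h : IsArtinianRing.equivPi B (maximalIdempotent M) M' =
      (Pi.single M 1 : ∀ M : MaximalSpectrum B, B ⧸ M.asIdeal) M' := by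
    rw [maximalIdempotent, AlgEquiv.apply_symm_apply]
  rw [IsArtinianRing.equivPi_apply] at h
  split_ifs with hM
  · subst hM
    rw [h, Pi.single_eq_same]
  · rw [h, Pi.single_eq_of_ne hM]

theorem eq_of_forall_quotient_mk_eq {x y : B}
    (h : ∀ M : MaximalSpectrum B, Ideal.Quotient.mk M.asIdeal x = Ideal.Quotient.mk M.asIdeal y) :
    x = y :=
  (IsArtinianRing.equivPi B).injective (funext h)

theorem completeOrthogonalIdempotents_maximalIdempotent [Fintype (MaximalSpectrum B)] :
    CompleteOrthogonalIdempotents (maximalIdempotent (B := B)) :=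
  letI := Classical.decEq (MaximalSpectrum B)
  (CompleteOrthogonalIdempotents.single fun M : MaximalSpectrum B => B ⧸ M.asIdeal).map
    ((IsArtinianRing.equivPi B).symm : (∀ M : MaximalSpectrum B, B ⧸ M.asIdeal) →+* B)

theorem maximalIdempotent_mul_eq_zero {M : MaximalSpectrum B} {b : B} :
    maximalIdempotent M * b = 0 ↔ b ∈ M.asIdeal := by
  classical
  constructor
  · intro h
    have := congrArg (Ideal.Quotient.mk M.asIdeal) h
    rwa [map_mul, quotient_mk_maximalIdempotent, if_pos rfl, one_mul, map_zero,
      Ideal.Quotient.eq_zero_iff_mem] at this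
  · intro h
    refine eq_of_forall_quotient_mk_eq fun M' => ?_
    rw [map_mul, quotient_mk_maximalIdempotent, map_zero]
    split_ifs with hM
    · rw [hM, one_mul, Ideal.Quotient.eq_zero_iff_mem]
      exact h
    · rw [zero_mul]

theorem maximalIdempotent_ne_zero (M : MaximalSpectrum B) : maximalIdempotent M ≠ 0 := by
  intro h
  have := (maximalIdempotent_mul_eq_zero (M := M) (b := 1)).1 (by rw [h, zero_mul])
  exact M.isMaximal.ne_top ((Ideal.eq_top_iff_one _).2 this)

/-- The preimage of a maximal ideal under an involution of the ring. -/
def MaximalSpectrum.comapInvolution {B : Type*} [CommRing B] (s : B →+* B)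
    (hs : ∀ b, s (s b) = b) (M : MaximalSpectrum B) : MaximalSpectrum B :=
  ⟨M.asIdeal.comap s, have := M.isMaximal
    Ideal.comap_isMaximal_of_surjective s fun b => ⟨s b, hs b⟩⟩

theorem map_maximalIdempotent (s : B →+* B) (hs : ∀ b, s (s b) = b) (M : MaximalSpectrum B) :
    s (maximalIdempotent M) = maximalIdempotent (M.comapInvolution s hs) := by
  classical
  have hmk : ∀ (M' : MaximalSpectrum B) (x y : B), Ideal.Quotient.mk M'.asIdeal (s x) =
      Ideal.Quotient.mk M'.asIdeal (s y) ↔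
      Ideal.Quotient.mk (M'.comapInvolution s hs).asIdeal x =
        Ideal.Quotient.mk (M'.comapInvolution s hs).asIdeal y := by
    intro M' x y
    rw [Ideal.Quotient.eq, Ideal.Quotient.eq, ← map_sub]
    rfl
  have hinv : ∀ M' : MaximalSpectrum B,
      (M'.comapInvolution s hs).comapInvolution s hs = M' := by
    intro M'
    ext b
    change s (s b) ∈ M'.asIdeal ↔ _
    rw [hs]
  refine eq_of_forall_quotient_mk_eq fun M' => ?_
  rw [quotient_mk_maximalIdempotent]
  split_ifs with h
  · rw [← map_one (Ideal.Quotient.mk M'.asIdeal), ← map_one s, hmk, h, hinv,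
      quotient_mk_maximalIdempotent, if_pos rfl, map_one]
  · rw [← map_zero (Ideal.Quotient.mk M'.asIdeal), ← map_zero s, hmk,
      quotient_mk_maximalIdempotent, if_neg, map_zero]
    rintro rfl
    exact h (hinv M').symm

end Idempotents

/-! ### The components of the group algebra -/

section Components

variable {F A : Type*} [Field F] [AddCommGroup A] [IsArtinianRing (AddMonoidAlgebra F A)]
  [IsReduced (AddMonoidAlgebra F A)]

/-- The image in `F[A × ZMod N]` of the idempotent of `F[A]` that belongs to `M`. -/
noncomputable def componentIdempotent (N : ℕ) (M : MaximalSpectrum (AddMonoidAlgebra F A)) :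
    AddMonoidAlgebra F (A × ZMod N) :=
  groupAlgebraInl F A N (maximalIdempotent M)

/-- Since `F[A]` is a product of fields, `F[A × ZMod (p ^ k)]`, which is `F[A][t]` with
`t ^ p ^ k = 0`, is a product of uniserial rings. -/
theorem isUniserialDecomposition_groupAlgebra [Fintype (MaximalSpectrum (AddMonoidAlgebra F A))]
    (p : ℕ) [Fact p.Prime] [CharP F p] (k : ℕ) :
    IsUniserialDecomposition
      (componentIdempotent (p ^ k) : MaximalSpectrum (AddMonoidAlgebra F A) → _)
      (cyclicUniformizer F A (p ^ k)) (p ^ k) where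
  complete := completeOrthogonalIdempotents_maximalIdempotent.map (groupAlgebraInl F A (p ^ k))
  pow_eq_zero := cyclicUniformizer_pow_card p k
  mul_pow_ne_zero := by
    intro M n hn h
    refine maximalIdempotent_ne_zero M (eq_zero_of_mul_cyclicUniformizer_pow p k _ ?_)
    rw [show p ^ k - 1 = n + (p ^ k - 1 - n) by omega, pow_add, ← mul_assoc]
    rw [componentIdempotent] at h
    rw [h, zero_mul]
  dvd_or_exists := by
    intro M x
    have : NeZero (p ^ k) := ⟨pow_ne_zero _ (Fact.out : p.Prime).ne_zero⟩
    obtain ⟨z, hz⟩ := cyclicUniformizer_dvd x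
    set b := groupAlgebraFst F A (p ^ k) x
    rw [componentIdempotent]
    by_cases hb : b ∈ M.asIdeal
    · left
      have h0 := congrArg (groupAlgebraInl F A (p ^ k)) (maximalIdempotent_mul_eq_zero.2 hb)
      rw [map_mul, map_zero] at h0
      refine ⟨groupAlgebraInl F A (p ^ k) (maximalIdempotent M) * z, ?_⟩
      linear_combination groupAlgebraInl F A (p ^ k) (maximalIdempotent M) * hz + h0
    · right
      have := M.isMaximal
      obtain ⟨y, hy⟩ : ∃ y, 1 - y * b ∈ M.asIdeal := by
        obtain ⟨y, i, hi, h1⟩ := Ideal.IsMaximal.exists_inv ‹_› hb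
        exact ⟨y, by rw [← h1, add_sub_cancel_left]; exact hi⟩
      have h0 := congrArg (groupAlgebraInl F A (p ^ k)) (maximalIdempotent_mul_eq_zero.2 hy)
      rw [map_mul, map_sub, map_mul, map_one, map_zero] at h0
      refine ⟨groupAlgebraInl F A (p ^ k) y, -(groupAlgebraInl F A (p ^ k) y *
        groupAlgebraInl F A (p ^ k) (maximalIdempotent M) * z), ?_⟩
      linear_combination h0 - groupAlgebraInl F A (p ^ k) y *
        groupAlgebraInl F A (p ^ k) (maximalIdempotent M) * hz

/-- The minimal ideals of the components have the same dimensions as the residue fields. -/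
theorem finrank_span_component [Finite A] (p : ℕ) [Fact p.Prime] [CharP F p] (k : ℕ)
    (M : MaximalSpectrum (AddMonoidAlgebra F A)) :
    Module.finrank F ((Ideal.span {componentIdempotent (p ^ k) M *
      cyclicUniformizer F A (p ^ k) ^ (p ^ k - 1)}).restrictScalars F) =
      Module.finrank F (AddMonoidAlgebra F A ⧸ M.asIdeal) := by
  have hN : 0 < p ^ k := pow_pos (Fact.out : p.Prime).pos k
  have : NeZero (p ^ k) := ⟨hN.ne'⟩
  set s := componentIdempotent (p ^ k) M * cyclicUniformizer F A (p ^ k) ^ (p ^ k - 1) with hs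
  let f : AddMonoidAlgebra F A →ₗ[F] AddMonoidAlgebra F (A × ZMod (p ^ k)) :=
    { toFun := fun b => groupAlgebraInl F A (p ^ k) b * s
      map_add' := fun x y => by rw [map_add, add_mul]
      map_smul' := fun c x => by rw [groupAlgebraInl_smul, smul_mul_assoc, RingHom.id_apply] }
  have hker : LinearMap.ker f = M.asIdeal.restrictScalars F := by
    ext b
    rw [LinearMap.mem_ker, Submodule.restrictScalars_mem, ← maximalIdempotent_mul_eq_zero]
    change groupAlgebraInl F A (p ^ k) b * s = 0 ↔ _
    rw [hs, componentIdempotent, ← mul_assoc, ← map_mul, mul_comm b]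
    constructor
    · exact eq_zero_of_mul_cyclicUniformizer_pow p k _
    · intro h
      rw [h, map_zero, zero_mul]
  have hrange : LinearMap.range f = (Ideal.span {s}).restrictScalars F := by
    ext x
    simp only [LinearMap.mem_range, Submodule.restrictScalars_mem, Ideal.mem_span_singleton]
    constructor
    · rintro ⟨b, rfl⟩
      exact dvd_mul_left _ _
    · rintro ⟨y, rfl⟩
      refine ⟨groupAlgebraFst F A (p ^ k) y, ?_⟩
      change groupAlgebraInl F A (p ^ k) (groupAlgebraFst F A (p ^ k) y) * s = s * y
      obtain ⟨z, hz⟩ := cyclicUniformizer_dvd y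
      have h0 : s * cyclicUniformizer F A (p ^ k) = 0 := by
        rw [hs, mul_assoc, ← pow_succ, Nat.sub_add_cancel hN, cyclicUniformizer_pow_card, mul_zero]
      linear_combination -s * hz - z * h0
  rw [← hrange, ← LinearEquiv.finrank_eq f.quotKerEquivRange, hker]
  exact LinearEquiv.finrank_eq (Submodule.Quotient.restrictScalarsEquiv F M.asIdeal)

end Components

/-! ### The Hermitian hull -/

section Hull

variable {F A : Type*} [Field F] [AddCommGroup A] [IsArtinianRing (AddMonoidAlgebra F A)]
  [IsReduced (AddMonoidAlgebra F A)]

/-- The conjugation maps the `M`-component of `F[A × ZMod (p ^ k)]` onto the component of the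
conjugate maximal ideal. -/
theorem groupAlgebraConj_component_mem_iff (p ν : ℕ) [Fact p.Prime] [CharP F p] (k : ℕ)
    (hF : Nat.card F = p ^ (2 * ν)) (D : Ideal (AddMonoidAlgebra F (A × ZMod (p ^ k))))
    (M : MaximalSpectrum (AddMonoidAlgebra F A)) (n : ℕ) :
    groupAlgebraConj F _ p ν (componentIdempotent (p ^ k) M * cyclicUniformizer F A (p ^ k) ^ n) ∈
        D ↔
      componentIdempotent (p ^ k) (M.comapInvolution (groupAlgebraConj F A p ν)
        (groupAlgebraConj_groupAlgebraConj p ν hF)) * cyclicUniformizer F A (p ^ k) ^ n ∈ D := by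
  obtain ⟨u, hu⟩ := groupAlgebraConj_cyclicUniformizer (F := F) (A := A) (N := p ^ k) p ν
  rw [map_mul, map_pow, hu, mul_pow, componentIdempotent, groupAlgebraConj_groupAlgebraInl,
    map_maximalIdempotent _ (groupAlgebraConj_groupAlgebraConj p ν hF), componentIdempotent,
    ← Units.val_pow_eq_pow_val, mul_left_comm]
  exact Ideal.unit_mul_mem_iff_mem D (u ^ n).isUnit

variable [Fintype (MaximalSpectrum (AddMonoidAlgebra F A))]

/-- If `C` has the exponents `e M`, and `σ` is the action of the conjugation on the maximal ideals
of `F[A]`, then the Hermitian dual of `C` has the exponents `p ^ k - e (σ M)`. -/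
theorem exists_ideal_eq_hermitianHull (p ν : ℕ) [Fact p.Prime] [CharP F p] (k : ℕ)
    [Finite (A × ZMod (p ^ k))]
    (hF : Nat.card F = p ^ (2 * ν)) (C : Ideal (AddMonoidAlgebra F (A × ZMod (p ^ k)))) :
    ∃ H : Ideal (AddMonoidAlgebra F (A × ZMod (p ^ k))),
      H.restrictScalars F = hermitianHull p ν C ∧
      ∀ M : MaximalSpectrum (AddMonoidAlgebra F A),
        idealExponent (componentIdempotent (p ^ k)) (cyclicUniformizer F A (p ^ k)) H M =
          max (idealExponent (componentIdempotent (p ^ k)) (cyclicUniformizer F A (p ^ k)) C M)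
            (p ^ k - idealExponent (componentIdempotent (p ^ k)) (cyclicUniformizer F A (p ^ k)) C
              (M.comapInvolution (groupAlgebraConj F A p ν)
                (groupAlgebraConj_groupAlgebraConj p ν hF))) := by
  have h := isUniserialDecomposition_groupAlgebra (F := F) (A := A) p k
  refine ⟨C ⊓ C.annihilator.comap (groupAlgebraConj F _ p ν), ?_, fun M => ?_⟩
  · ext v
    simp only [hermitianHull, Submodule.restrictScalars_mem, Submodule.mem_inf, Ideal.mem_comap,
      mem_hermitianDual_iff]
  · refine h.idealExponent_eq _ _ _ fun n => ?_
    rw [Submodule.mem_inf, Ideal.mem_comap, groupAlgebraConj_component_mem_iff p ν k hF,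
      h.mem_iff, h.mem_iff, h.idealExponent_annihilator, max_le_iff]

theorem avgHermitianHullDim_eq_sum [Finite A] (p ν : ℕ) [Fact p.Prime] [CharP F p] (k : ℕ)
    [Finite (A × ZMod (p ^ k))] (hF : Nat.card F = p ^ (2 * ν)) :
    avgHermitianHullDim F (A × ZMod (p ^ k)) p ν =
      ∑ M : MaximalSpectrum (AddMonoidAlgebra F A),
        (Module.finrank F (AddMonoidAlgebra F A ⧸ M.asIdeal) : ℚ) *
        (letI := Classical.decEq (MaximalSpectrum (AddMonoidAlgebra F A))
        if M.comapInvolution (groupAlgebraConj F A p ν)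
            (groupAlgebraConj_groupAlgebraConj p ν hF) = M then
          (((p ^ k) ^ 2 / 4 : ℕ) : ℚ) / ((p ^ k : ℕ) + 1)
        else ((p ^ k : ℕ) : ℚ) * (2 * (p ^ k : ℕ) + 1) / (6 * ((p ^ k : ℕ) + 1))) := by
  classical
  have h := isUniserialDecomposition_groupAlgebra (F := F) (A := A) p k
  set σ : MaximalSpectrum (AddMonoidAlgebra F A) → MaximalSpectrum (AddMonoidAlgebra F A) :=
    fun M => M.comapInvolution (groupAlgebraConj F A p ν)
      (groupAlgebraConj_groupAlgebraConj p ν hF) with hσ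
  have hdim : ∀ C : Ideal (AddMonoidAlgebra F (A × ZMod (p ^ k))),
      (Module.finrank F (hermitianHull p ν C) : ℚ) =
        ∑ M, (Module.finrank F (AddMonoidAlgebra F A ⧸ M.asIdeal) : ℚ) *
          ((min (p ^ k - (h.idealEquiv C M : ℕ)) (h.idealEquiv C (σ M) : ℕ) : ℕ) : ℚ) := by
    intro C
    obtain ⟨H, hH, hexp⟩ := exists_ideal_eq_hermitianHull p ν k hF C
    rw [← hH, h.finrank_ideal, Nat.cast_sum]
    refine Finset.sum_congr rfl fun M _ => ?_
    rw [finrank_span_component, mul_comm, ← Nat.cast_mul, hexp, h.idealEquiv_apply,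
      h.idealEquiv_apply]
    have h1 := h.idealExponent_le C (σ M)
    congr 2
    simp only [hσ] at h1 ⊢
    omega
  rw [avgHermitianHullDim, finsum_congr hdim, Nat.card_congr h.idealEquiv, Nat.card_eq_fintype_card,
    finsum_eq_of_bijective h.idealEquiv h.idealEquiv.bijective
      (g := fun e => ∑ M, (Module.finrank F (AddMonoidAlgebra F A ⧸ M.asIdeal) : ℚ) *
          ((min (p ^ k - (e M : ℕ)) (e (σ M) : ℕ) : ℕ) : ℚ)) fun C => rfl,
    finsum_eq_sum_of_fintype, Finset.sum_comm, Finset.sum_div]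
  refine Finset.sum_congr rfl fun M _ => ?_
  rw [← Finset.mul_sum, mul_div_assoc, sum_min_sub_div_card]

end Hull

/-! ### Residue fields and characters -/

section ResidueFields

variable {F B L : Type*} [Field F] [CommRing B] [Algebra F B] [Field L] [Algebra F L]

/-- The kernel of a homomorphism from an Artinian algebra to a field, as a maximal ideal. -/
def AlgHom.maximalKer [IsArtinianRing B] (φ : B →ₐ[F] L) : MaximalSpectrum B :=
  ⟨RingHom.ker φ, have := RingHom.ker_isPrime φ; IsArtinianRing.isMaximal_of_isPrime _⟩

/-- The homomorphisms with kernel `M` are the embeddings of the residue field of `M`. -/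
noncomputable def algHomKerEquiv [IsArtinianRing B] (M : MaximalSpectrum B) :
    {φ : B →ₐ[F] L // φ.maximalKer = M} ≃ (B ⧸ M.asIdeal →ₐ[F] L) where
  toFun φ := Ideal.Quotient.liftₐ M.asIdeal φ.1 fun b hb => by
    rw [← φ.2] at hb
    exact hb
  invFun ψ := ⟨ψ.comp (Ideal.Quotient.mkₐ F M.asIdeal), by
    have := M.isMaximal
    let _ := Ideal.Quotient.field M.asIdeal
    ext b
    change ψ (Ideal.Quotient.mk M.asIdeal b) = 0 ↔ _
    rw [map_eq_zero_iff ψ (RingHom.injective ψ.toRingHom), Ideal.Quotient.eq_zero_iff_mem]⟩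
  left_inv φ := Subtype.ext (AlgHom.ext fun b => rfl)
  right_inv ψ := Ideal.Quotient.algHom_ext _ (AlgHom.ext fun b => rfl)

variable [Finite F] [Module.Finite F B] [IsArtinianRing B]

theorem finrank_residueField_eq_card [IsAlgClosed L] (M : MaximalSpectrum B) :
    Module.finrank F (B ⧸ M.asIdeal) = Nat.card {φ : B →ₐ[F] L // φ.maximalKer = M} := by
  have := M.isMaximal
  let _ := Ideal.Quotient.field M.asIdeal
  rw [Nat.card_congr (algHomKerEquiv M), Nat.card_eq_fintype_card, AlgHom.card]

theorem sum_finrank_residueField [IsAlgClosed L] [Fintype (MaximalSpectrum B)]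
    (P : MaximalSpectrum B → Prop) [DecidablePred P] :
    ∑ M with P M, Module.finrank F (B ⧸ M.asIdeal) =
      Nat.card {φ : B →ₐ[F] L // P φ.maximalKer} := by
  rw [Finset.sum_congr rfl fun M _ => finrank_residueField_eq_card (L := L) M]
  have hfin : ∀ M : MaximalSpectrum B, Finite {φ : B →ₐ[F] L // φ.maximalKer = M} := fun M =>
    have := M.isMaximal
    let _ := Ideal.Quotient.field M.asIdeal
    Finite.of_equiv _ (algHomKerEquiv M).symm
  rw [← Finset.sum_coe_sort, ← Nat.card_sigma]
  refine Nat.card_congr ?_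
  exact
    { toFun := fun x => ⟨x.2.1, by rw [x.2.2]; exact (Finset.mem_filter.1 x.1.2).2⟩
      invFun := fun φ => ⟨⟨φ.1.maximalKer, by simpa using φ.2⟩, ⟨φ.1, rfl⟩⟩
      left_inv := by
        rintro ⟨⟨M, hM⟩, ⟨φ, hφ⟩⟩
        have hφM : φ.maximalKer = M := hφ
        subst hφM
        rfl
      right_inv := fun φ => rfl }

/-- Since the Galois group of a residue field is generated by the Frobenius automorphism, two
homomorphisms to `L` have the same kernel if and only if they differ by a power of it. -/
theorem maximalKer_eq_iff [IsAlgClosed L] (φ ψ : B →ₐ[F] L) :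
    ψ.maximalKer = φ.maximalKer ↔ ∃ j : ℕ, ∀ b, ψ b = φ b ^ Nat.card F ^ j := by
  constructor
  · intro h
    set M := φ.maximalKer with hM
    have := M.isMaximal
    let _ := Ideal.Quotient.field M.asIdeal
    have : Finite (B ⧸ M.asIdeal) := Module.finite_of_finite F
    have := Fintype.ofFinite F
    set φ' : B ⧸ M.asIdeal →ₐ[F] L := algHomKerEquiv M ⟨φ, rfl⟩ with hφ'
    set ψ' : B ⧸ M.asIdeal →ₐ[F] L := algHomKerEquiv M ⟨ψ, h⟩ with hψ'
    have hinj : Function.Injective fun g : B ⧸ M.asIdeal →ₐ[F] B ⧸ M.asIdeal => φ'.comp g :=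
      fun g₁ g₂ h => AlgHom.ext fun x =>
        φ'.toRingHom.injective (DFunLike.congr_fun h x)
    have hfrob := FiniteField.bijective_frobeniusAlgHom_pow F (B ⧸ M.asIdeal)
    -- the residue field has as many embeddings into `L` as it has automorphisms over `F`
    have hbij : Function.Bijective fun n : Fin (Module.finrank F (B ⧸ M.asIdeal)) =>
        φ'.comp (FiniteField.frobeniusAlgHom F (B ⧸ M.asIdeal) ^ n.1) :=
      (hinj.comp hfrob.1).bijective_of_nat_card_le (by
        rw [Nat.card_eq_fintype_card, AlgHom.card, Nat.card_eq_fintype_card, Fintype.card_fin])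
    obtain ⟨n, hn⟩ := hbij.2 ψ'
    refine ⟨n.1, fun b => ?_⟩
    have hb := DFunLike.congr_fun hn (Ideal.Quotient.mk M.asIdeal b)
    simp only [AlgHom.comp_apply, AlgHom.coe_pow, FiniteField.coe_frobeniusAlgHom, pow_iterate,
      map_pow] at hb
    rw [Nat.card_eq_fintype_card]
    exact hb.symm
  · rintro ⟨j, hj⟩
    ext b
    change ψ b = 0 ↔ φ b = 0
    rw [hj, pow_eq_zero_iff (pow_ne_zero _ Nat.card_pos.ne')]

end ResidueFields

section Characters

variable {F A L : Type*} [Field F] [AddCommGroup A] [Field L] [Algebra F L]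

/-- The homomorphisms from `F[A]` to `L` are the characters of `A` with values in `L`. -/
noncomputable def characterEquiv (F A L : Type*) [Field F] [AddCommGroup A] [Field L]
    [Algebra F L] : (Multiplicative A →* Lˣ) ≃ (AddMonoidAlgebra F A →ₐ[F] L) :=
  Equiv.trans
    { toFun := fun χ => (Units.coeHom L).comp χ
      invFun := fun f => f.toHomUnits
      left_inv := fun χ => by ext; rfl
      right_inv := fun f => by ext; rfl }
    (AddMonoidAlgebra.lift F L A)

theorem characterEquiv_single (χ : Multiplicative A →* Lˣ) (a : A) (r : F) :
    characterEquiv F A L χ (single a r) = r • (χ (Multiplicative.ofAdd a) : L) := by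
  simp [characterEquiv]

/-- The composite of the homomorphism of the character `χ` with the conjugation has the same
kernel as the homomorphism of `χ ^ (-p ^ ν)`. -/
theorem comapInvolution_maximalKer (p ν : ℕ) [Fact p.Prime] [CharP F p]
    [IsArtinianRing (AddMonoidAlgebra F A)] (hF : Nat.card F = p ^ (2 * ν))
    (χ : Multiplicative A →* Lˣ) :
    (characterEquiv F A L χ).maximalKer.comapInvolution (groupAlgebraConj F A p ν)
      (groupAlgebraConj_groupAlgebraConj p ν hF) =
        (characterEquiv F A L (χ ^ p ^ ν)⁻¹).maximalKer := by
  have : CharP L p := charP_of_injective_algebraMap (algebraMap F L).injective p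
  have hcomp : (iterateFrobenius L p ν).comp
      ((characterEquiv F A L χ).toRingHom.comp (groupAlgebraConj F A p ν)) =
        (characterEquiv F A L (χ ^ p ^ ν)⁻¹).toRingHom := by
    apply AddMonoidAlgebra.ringHom_ext
    · intro r
      simp [groupAlgebraConj_single, characterEquiv_single, iterateFrobenius_def, smul_pow,
        pow_pow_eq_self_of_card hF]
    · intro a
      simp [groupAlgebraConj_single, characterEquiv_single, iterateFrobenius_def]
  ext b
  change characterEquiv F A L χ (groupAlgebraConj F A p ν b) = 0 ↔
    characterEquiv F A L (χ ^ p ^ ν)⁻¹ b = 0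
  have hb := RingHom.congr_fun hcomp b
  simp only [RingHom.comp_apply, iterateFrobenius_def, AlgHom.toRingHom_eq_coe,
    RingHom.coe_coe] at hb
  rw [← hb, pow_eq_zero_iff (pow_ne_zero _ (Fact.out : p.Prime).ne_zero)]

theorem comapInvolution_maximalKer_eq_iff [IsAlgClosed L] [Finite A] (p ν : ℕ) [Fact p.Prime]
    [CharP F p] [IsArtinianRing (AddMonoidAlgebra F A)] (hF : Nat.card F = p ^ (2 * ν))
    (χ : Multiplicative A →* Lˣ) :
    (characterEquiv F A L χ).maximalKer.comapInvolution (groupAlgebraConj F A p ν)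
      (groupAlgebraConj_groupAlgebraConj p ν hF) = (characterEquiv F A L χ).maximalKer ↔
        Additive.ofMul χ ∈ hermitianSelfPaired (Additive (Multiplicative A →* Lˣ)) p ν := by
  have hfin : Finite F := Nat.finite_of_card_ne_zero (by
    rw [hF]; exact pow_ne_zero _ (Fact.out : p.Prime).ne_zero)
  rw [comapInvolution_maximalKer p ν hF, maximalKer_eq_iff, hF]
  refine exists_congr fun j => ?_
  have : -(p ^ ν • Additive.ofMul χ) = (p ^ (2 * ν)) ^ j • Additive.ofMul χ ↔
      (χ ^ p ^ ν)⁻¹ = χ ^ (p ^ (2 * ν)) ^ j := Iff.rfl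
  rw [this]
  constructor
  · intro h
    ext a
    have ha := h (single a 1)
    simpa [characterEquiv_single] using ha
  · intro h b
    have := Fintype.ofFinite F
    have hcomp : characterEquiv F A L (χ ^ p ^ ν)⁻¹ =
        (FiniteField.frobeniusAlgHom F L ^ j).comp (characterEquiv F A L χ) := by
      refine AddMonoidAlgebra.algHom_ext (fun a => ?_) (Subsingleton.elim _ _)
      rw [h, AlgHom.comp_apply, AlgHom.coe_pow, FiniteField.coe_frobeniusAlgHom, pow_iterate,
        ← Nat.card_eq_fintype_card, hF]
      simp [characterEquiv_single]
    rw [hcomp, AlgHom.comp_apply, AlgHom.coe_pow, FiniteField.coe_frobeniusAlgHom, pow_iterate,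
      ← Nat.card_eq_fintype_card, hF]

theorem ncard_hermitianSelfPaired_congr {A B : Type*} [AddCommGroup A] [AddCommGroup B]
    (e : A ≃+ B) (p ν : ℕ) :
    (hermitianSelfPaired A p ν).ncard = (hermitianSelfPaired B p ν).ncard := by
  refine Set.ncard_congr (fun a _ => e a) ?_ (fun a b _ _ h => e.injective h) ?_
  · rintro a ⟨i, hi⟩
    exact ⟨i, by rw [← map_nsmul, ← map_neg, hi, map_nsmul]⟩
  · rintro b ⟨i, hi⟩
    exact ⟨e.symm b, ⟨i, by rw [← map_nsmul, ← map_neg, hi, map_nsmul]⟩, e.apply_symm_apply b⟩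

theorem nonempty_characters_addEquiv (F : Type*) [Field F] {A : Type*} [AddCommGroup A]
    [Finite A] (p : ℕ) [Fact p.Prime] [CharP F p] (hA : ¬ p ∣ Nat.card A) :
    Nonempty (Additive (Multiplicative A →* (AlgebraicClosure F)ˣ) ≃+ A) := by
  have hexp : NeZero ((Monoid.exponent (Multiplicative A) : ℕ) : F) := by
    refine ⟨fun h => hA ?_⟩
    rw [CharP.cast_eq_zero_iff F p] at h
    exact h.trans (Group.exponent_dvd_nat_card (G := Multiplicative A))
  obtain ⟨e⟩ := CommGroup.monoidHom_mulEquiv_of_hasEnoughRootsOfUnity (Multiplicative A)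
    (AlgebraicClosure F)
  exact ⟨MulEquiv.toAdditiveLeft e⟩

/-- The residue fields of the conjugation-invariant maximal ideals of `F[A]` have total dimension
`|R(A)|`: the homomorphisms with such kernels are the self-paired characters, and the character
group is isomorphic to `A`. -/
theorem sum_finrank_residueField_invariant [Finite A] (p ν : ℕ) [Fact p.Prime] [CharP F p]
    (hA : ¬ p ∣ Nat.card A) [IsArtinianRing (AddMonoidAlgebra F A)]
    [Fintype (MaximalSpectrum (AddMonoidAlgebra F A))] (hF : Nat.card F = p ^ (2 * ν))
    [DecidablePred fun M : MaximalSpectrum (AddMonoidAlgebra F A) =>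
      M.comapInvolution (groupAlgebraConj F A p ν)
        (groupAlgebraConj_groupAlgebraConj p ν hF) = M] :
    ∑ M : MaximalSpectrum (AddMonoidAlgebra F A) with
      M.comapInvolution (groupAlgebraConj F A p ν)
        (groupAlgebraConj_groupAlgebraConj p ν hF) = M,
      Module.finrank F (AddMonoidAlgebra F A ⧸ M.asIdeal) = (hermitianSelfPaired A p ν).ncard := by
  have hfin : Finite F := Nat.finite_of_card_ne_zero (by
    rw [hF]; exact pow_ne_zero _ (Fact.out : p.Prime).ne_zero)
  rw [sum_finrank_residueField (L := AlgebraicClosure F),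
    ← ncard_hermitianSelfPaired_congr (A := Additive (Multiplicative A →* (AlgebraicClosure F)ˣ))
      (nonempty_characters_addEquiv F p hA).some, ← Nat.card_coe_set_eq]
  exact Nat.card_congr ((characterEquiv F A _).subtypeEquiv fun χ =>
    (comapInvolution_maximalKer_eq_iff p ν hF χ).symm).symm

theorem sum_finrank_residueField_univ [Finite F] [Finite A] (p : ℕ) [Fact p.Prime] [CharP F p]
    (hA : ¬ p ∣ Nat.card A) [IsArtinianRing (AddMonoidAlgebra F A)]
    [Fintype (MaximalSpectrum (AddMonoidAlgebra F A))] :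
    ∑ M : MaximalSpectrum (AddMonoidAlgebra F A),
      Module.finrank F (AddMonoidAlgebra F A ⧸ M.asIdeal) = Nat.card A := by
  have h := sum_finrank_residueField (F := F) (B := AddMonoidAlgebra F A)
    (L := AlgebraicClosure F) fun _ => True
  rw [Finset.filter_true] at h
  rw [h, ← Nat.card_congr (nonempty_characters_addEquiv F p hA).some.toEquiv]
  exact Nat.card_congr ((Equiv.subtypeUnivEquiv fun _ => trivial).trans (characterEquiv F A _).symm)

end Characters

/-! ### The average dimension -/

/-- The mean `⌊N ^ 2 / 4⌋ / (N + 1)` of an invariant component, for `N = p ^ k`, in terms of the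
mean of the other components. -/
theorem sq_div_four_div_eq (p k : ℕ) [Fact p.Prime] (δ : ℚ)
    (hδ : δ = if p = 2 ∧ 1 ≤ k then 1 else 0) :
    (((p ^ k) ^ 2 / 4 : ℕ) : ℚ) / ((p ^ k : ℕ) + 1) =
      ((p ^ k : ℕ) : ℚ) * (2 * (p ^ k : ℕ) + 1) / (6 * ((p ^ k : ℕ) + 1)) -
        (((p : ℚ) ^ k + 1) / 12 + (2 - 3 * δ) / (12 * ((p : ℚ) ^ k + 1))) := by
  have hp : p.Prime := Fact.out
  have hpos : ((p : ℚ) ^ k + 1) ≠ 0 := by positivity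
  have hsq : 4 * (((p ^ k) ^ 2 / 4 : ℕ) : ℚ) = ((p : ℚ) ^ k) ^ 2 - (1 - δ) := by
    by_cases h : p = 2 ∧ 1 ≤ k
    · have h4 : 4 * ((p ^ k) ^ 2 / 4) = (p ^ k) ^ 2 := by
        refine Nat.mul_div_cancel' ?_
        obtain ⟨rfl, hk⟩ := h
        exact pow_dvd_pow_of_dvd (dvd_pow_self 2 (by omega)) 2
      rw [hδ, if_pos h, sub_self, sub_zero]
      exact_mod_cast h4
    · have hodd : Odd (p ^ k) := by
        rcases Nat.eq_zero_or_pos k with rfl | hk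
        · simp
        · exact (hp.odd_of_ne_two fun h2 => h ⟨h2, hk⟩).pow
      have h4 : 4 * ((p ^ k) ^ 2 / 4) + 1 = (p ^ k) ^ 2 := by
        obtain ⟨c, hc⟩ := hodd
        have : (p ^ k) ^ 2 = 4 * (c ^ 2 + c) + 1 := by rw [hc]; ring
        omega
      rw [hδ, if_neg h, sub_zero, eq_sub_iff_add_eq]
      exact_mod_cast h4
  push_cast at hsq ⊢
  field_simp
  linear_combination 18 * hsq

theorem theorem4 (p : ℕ) [Fact p.Prime] (ν : ℕ) (hν : 0 < ν) (k : ℕ)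
    (F : Type*) [Field F] [CharP F p] (hF : Nat.card F = p ^ (2 * ν))
    (A : Type*) [AddCommGroup A] [Finite A] (m : ℕ) (hm : Nat.card A = m) (hpm : ¬ p ∣ m)
    (δ : ℚ) (hδ : δ = if p = 2 ∧ 1 ≤ k then 1 else 0) :
    avgHermitianHullDim F (A × ZMod (p ^ k)) p ν =
      (m : ℚ) * (p : ℚ) ^ k * (1 / 3 - 1 / (6 * ((p : ℚ) ^ k + 1))) -
        ((hermitianSelfPaired A p ν).ncard : ℚ) *
          (((p : ℚ) ^ k + 1) / 12 + (2 - 3 * δ) / (12 * ((p : ℚ) ^ k + 1))) := by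
  classical
  subst hm
  have hfin : Finite F := Nat.finite_of_card_ne_zero (by
    rw [hF]; exact pow_ne_zero _ (Fact.out : p.Prime).ne_zero)
  have := isReduced_addMonoidAlgebra (F := F) p hpm
  have : IsArtinianRing (AddMonoidAlgebra F A) := IsArtinianRing.of_finite F _
  have := Fintype.ofFinite (MaximalSpectrum (AddMonoidAlgebra F A))
  have hu := sum_finrank_residueField_univ (F := F) p hpm
  have hi := sum_finrank_residueField_invariant p ν hpm hF
  rw [avgHermitianHullDim_eq_sum p ν k hF, ← hu, ← hi]
  simp only [sq_div_four_div_eq p k δ hδ, Finset.sum_filter]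
  push_cast
  rw [mul_assoc, Finset.sum_mul, Finset.sum_mul, ← Finset.sum_sub_distrib]
  refine Finset.sum_congr rfl fun M _ => ?_
  have hpos : ((p : ℚ) ^ k + 1) ≠ 0 := by positivity
  have hmean : (p : ℚ) ^ k * (2 * (p : ℚ) ^ k + 1) / (6 * ((p : ℚ) ^ k + 1)) =
      (p : ℚ) ^ k * (1 / 3 - 1 / (6 * ((p : ℚ) ^ k + 1))) := by
    field_simp
    ring
  rw [hmean]
  split_ifs <;> ring
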